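/- Let $X$ be a non-empty compact metric space and let $P(X)$ be the space of Borel probability measures on $X$ with the weak topology. Let $f=(f_1,\dots,f_n)$ be a finite family of contractions $f_i:X\to X$ (each Lipschitz with a constant $<1$). For $p$ in the simplex $S^{n-1}=\{p\in[0,1]^n:\sum_i p_i=1\}$ let $H_{f,p}:P(X)\to P(X)$, $H_{f,p}(\mu)=\sum_{i=1}^n p_i\,\mu\circ f_i^{-1}$. Given real numbers $p_i^-,p_i^+$ ($1\le i\le n$), let $K=S^{n-1}\cap\prod_{i}[p_i^-,p_i^+]$ be the set of admissible weight vectors. For a Hausdorff space $Y$ let $U(Y)$ be the set of non-empty compact subsets of $Y$ ordered by reverse inclusion. Let $\mathbb E_C(X)$ be the set of pairs $(C_1,C_2)$ of closed subsets of $X$ with $C_1\cup C_2=X$, ordered by componentwise reverse inclusion, and let $\mathbb I[0,1]$ be the set of non-empty closed intervals contained in $[0,1]$, ordered by reverse inclusion. Then: (1) for each $p\in K$ the operator $H_{f,p}$ has a unique fixed point $\operatorname{fix}(H_{f,p})\in P(X)$; (2) for every $B\in U(P(X))$ and every closed $C\subseteq X$ the maximum $\max_{\nu\in B}\nu(C)$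 exists, so that $$\mathcal L:U(P(X))\times\mathbb E_C(X)\to\mathbb I[0,1],\qquad \mathcal L(B,(C_1,C_2))=\Big[1-\max_{\nu\in B}\nu(C_1),\ \max_{\nu\in B}\nu(C_2)\Big]$$ is well defined; (3) for every $A\in U(K)$ the set $\operatorname{fix}(H_{f,[A]})=\{\operatorname{fix}(H_{f,p}):p\in A\}$ belongs to $U(P(X))$, and the composite map $$U(K)\times\mathbb E_C(X)\to\mathbb I[0,1],\qquad (A,(C_1,C_2))\mapsto \mathcal L\big(\operatorname{fix}(H_{f,[A]}),(C_1,C_2)\big)$$ is Scott continuous, i.e. it preserves all existing suprema of non-empty directed sets (in particular it is monotone). -/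

import Mathlib

open MeasureTheory TopologicalSpace

noncomputable section

namespace ImpreciseIFS

/-- The upper space `U(Y)`: non-empty compact subsets of `Y`, ordered by reverse inclusion. -/
abbrev UpperSpace (Y : Type*) [TopologicalSpace Y] : Type _ := (NonemptyCompacts Y)ᵒᵈ

/-- The subset of `Y` underlying a point of the upper space. -/
def UpperSpace.carrier {Y : Type*} [TopologicalSpace Y] (A : UpperSpace Y) : Set Y :=
  (OrderDual.ofDual A : NonemptyCompacts Y)

/-- The dual event domain: pairs of closed sets covering the space, ordered by componentwise
reverse inclusion. -/
abbrev DualEvent (X : Type*) [TopologicalSpace X] : Type _ :=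
  {C : (Closeds X)ᵒᵈ × (Closeds X)ᵒᵈ //
    ((OrderDual.ofDual C.1 : Closeds X) : Set X) ∪ ((OrderDual.ofDual C.2 : Closeds X) : Set X) =
      Set.univ}

/-- First closed set of the pair. -/
def DualEvent.fst {X : Type*} [TopologicalSpace X] (C : DualEvent X) : Set X :=
  (OrderDual.ofDual C.1.1 : Closeds X)

/-- Second closed set of the pair. -/
def DualEvent.snd {X : Type*} [TopologicalSpace X] (C : DualEvent X) : Set X :=
  (OrderDual.ofDual C.1.2 : Closeds X)

/-- The interval domain `𝕀[0,1]`: non-empty closed intervals contained in `[0,1]`, ordered by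
reverse inclusion. -/
abbrev IntervalDomain : Type := (NonemptyInterval unitInterval)ᵒᵈ

section Envelope

variable {X : Type*} [MeasurableSpace X]

/-- The set of values `ν(C)` for `ν ∈ A`. -/
def values (A : Set (ProbabilityMeasure X)) (C : Set X) : Set ℝ :=
  (fun ν : ProbabilityMeasure X => ((ν C : NNReal) : ℝ)) '' A

/-- The upper probability `sup {ν(C) : ν ∈ A}`. -/
def upperProb (A : Set (ProbabilityMeasure X)) (C : Set X) : ℝ := sSup (values A C)

theorem values_le_one {A : Set (ProbabilityMeasure X)} {C : Set X} {r : ℝ}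
    (hr : r ∈ values A C) : r ≤ 1 := by
  obtain ⟨ν, -, rfl⟩ := hr
  exact_mod_cast ν.apply_le_one C

theorem le_upperProb {A : Set (ProbabilityMeasure X)} {ν : ProbabilityMeasure X} (hν : ν ∈ A)
    (C : Set X) : ((ν C : NNReal) : ℝ) ≤ upperProb A C :=
  le_csSup ⟨1, fun _ hr => values_le_one hr⟩ ⟨ν, hν, rfl⟩

theorem upperProb_mem (A : Set (ProbabilityMeasure X)) (C : Set X) :
    upperProb A C ∈ Set.Icc (0 : ℝ) 1 := by
  constructor
  · apply Real.sSup_nonneg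
    rintro _ ⟨ν, -, rfl⟩
    exact NNReal.coe_nonneg _
  · exact Real.sSup_le (fun _ hr => values_le_one hr) zero_le_one

theorem one_sub_upperProb_le {A : Set (ProbabilityMeasure X)} (hA : A.Nonempty) {C₁ C₂ : Set X}
    (hC : C₁ ∪ C₂ = Set.univ) : 1 - upperProb A C₁ ≤ upperProb A C₂ := by
  obtain ⟨ν, hν⟩ := hA
  have h : (1 : ℝ) ≤ ((ν C₁ : NNReal) : ℝ) + ((ν C₂ : NNReal) : ℝ) := by
    have h' := ν.apply_union_le (s₁ := C₁) (s₂ := C₂)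
    rw [hC, ν.coeFn_univ] at h'
    exact_mod_cast h'
  linarith [le_upperProb hν C₁, le_upperProb hν C₂]

variable [TopologicalSpace X] [OpensMeasurableSpace X]

/-- The envelope map `𝓛 : U(P(X)) × 𝔼_C(X) → 𝕀[0,1]`,
`(A, (C₁, C₂)) ↦ [1 - sup {ν(C₁) : ν ∈ A}, sup {ν(C₂) : ν ∈ A}]`. -/
def envelope (q : UpperSpace (ProbabilityMeasure X) × DualEvent X) : IntervalDomain :=
  OrderDual.toDual
    { fst := ⟨1 - upperProb q.1.carrier q.2.fst,
        by linarith [(upperProb_mem q.1.carrier q.2.fst).2],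
        by linarith [(upperProb_mem q.1.carrier q.2.fst).1]⟩
      snd := ⟨upperProb q.1.carrier q.2.snd, upperProb_mem _ _⟩
      fst_le_snd := one_sub_upperProb_le (OrderDual.ofDual q.1).nonempty q.2.2 }

end Envelope

/-- An iterated function system: finitely many contracting self-maps (Lipschitz with a constant
`< 1`). -/
structure IFS (X : Type*) [MetricSpace X] (n : ℕ) where
  map : Fin n → X → X
  contracting : ∀ i, ∃ k : NNReal, ContractingWith k (map i)

/-- The admissible weight vectors: the simplex intersected with the box `∏ [lo i, hi i]`. -/
def admissible {n : ℕ} (lo hi : Fin n → ℝ) : Set (Fin n → ℝ) :=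
  stdSimplex ℝ (Fin n) ∩ Set.Icc lo hi

section Invariant

variable {X : Type*} [MetricSpace X] [MeasurableSpace X] [BorelSpace X] {n : ℕ}

theorem IFS.measurable_map (f : IFS X n) (i : Fin n) : Measurable (f.map i) := by
  obtain ⟨k, hk⟩ := f.contracting i
  exact hk.2.continuous.measurable

/-- The Markov operator `H_{f,p}(μ) = ∑ i, p i • (μ ∘ (f i)⁻¹)` on probability measures. -/
def markov (f : IFS X n) (p : stdSimplex ℝ (Fin n)) (μ : ProbabilityMeasure X) :
    ProbabilityMeasure X :=
  ⟨∑ i, ENNReal.ofReal (p.1 i) • (μ : Measure X).map (f.map i), ⟨by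
    have h : ∀ i, ((μ : Measure X).map (f.map i)) Set.univ = 1 := fun i => by
      rw [Measure.map_apply (f.measurable_map i) MeasurableSet.univ]
      simp
    simp only [Measure.coe_finsetSum, Finset.sum_apply, Measure.smul_apply, h, smul_eq_mul,
      mul_one]
    have h1 : ∑ i, ENNReal.ofReal (p.1 i) = ENNReal.ofReal (∑ i, p.1 i) :=
      (ENNReal.ofReal_sum_of_nonneg fun i _ => p.2.1 i).symm
    exact h1.trans (by rw [p.2.2, ENNReal.ofReal_one])⟩⟩

variable [Nonempty X]

instance probabilityMeasure_nonempty : Nonempty (ProbabilityMeasure X) :=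
  ⟨⟨Measure.dirac (Classical.arbitrary X), inferInstance⟩⟩

/-- `fix(H_{f,p})`: a fixed point of the Markov operator whenever there is one. -/
def fixH (f : IFS X n) (p : stdSimplex ℝ (Fin n)) : ProbabilityMeasure X :=
  Classical.epsilon fun μ => markov f p μ = μ

/-- `fix(H_{f,[A]}) = {fix(H_{f,p}) : p ∈ A}` for a compact set `A` of admissible weights. -/
def fixSet (f : IFS X n) {lo hi : Fin n → ℝ} (A : UpperSpace (admissible lo hi)) :
    Set (ProbabilityMeasure X) :=
  (fun p : admissible lo hi => fixH f ⟨p.1, p.2.1⟩) '' A.carrier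

/-- The map `fix(H_{f,[-]}) : U(K) → U(P(X))`, given that its values are compact. -/
def fixMap (f : IFS X n) {lo hi : Fin n → ℝ}
    (h : ∀ A : UpperSpace (admissible lo hi), IsCompact (fixSet f A))
    (A : UpperSpace (admissible lo hi)) : UpperSpace (ProbabilityMeasure X) :=
  OrderDual.toDual ⟨⟨fixSet f A, h A⟩, (OrderDual.ofDual A).nonempty.image _⟩

end Invariant

end ImpreciseIFS

end

namespace ImpreciseIFS

section Contraction

variable {X : Type*} [MetricSpace X] {n : ℕ}

/-! The Markov operator shrinks the Kantorovich distance by a common Lipschitz constant `k < 1`, so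
two measures lying in the ranges of all its iterates coincide. This gives uniqueness, and existence
too: by compactness of `P(X)` the nested ranges have a common point, whose image is again common.
The fixed point depends continuously on the weights because the fixed-point relation is closed and
`P(X)` is compact.

For Scott continuity, a directed supremum is controlled by an intersection. If every upper
probability is at least `r`, upper semicontinuity of `ν ↦ ν(C)` makes the weights witnessing this a
directed family of non-empty compact sets; a common weight vector then witnesses `r` at the supremum
(`exists_forall_le_fixH_of_directed`). -/

theorem IFS.exists_lipschitzWith_lt_one (f : IFS X n) :
    ∃ k : NNReal, k < 1 ∧ ∀ i, LipschitzWith k (f.map i) := by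
  choose k hk using f.contracting
  exact ⟨Finset.univ.sup k, (Finset.sup_lt_iff (by simp)).2 fun i _ => (hk i).1,
    fun i => (hk i).2.weaken (Finset.le_sup (Finset.mem_univ i))⟩

theorem IFS.continuous_map (f : IFS X n) (i : Fin n) : Continuous (f.map i) :=
  (f.contracting i).choose_spec.2.continuous

end Contraction

/-! ### Kantorovich distance -/

section Discrepancy

variable {X : Type*} [MetricSpace X] [MeasurableSpace X]

/-- The Kantorovich distance of `μ` and `ν`, taken over Lipschitz test functions, is at most `c`. -/
def LipschitzClose (c : ℝ) (μ ν : ProbabilityMeasure X) : Prop :=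
  ∀ (L : NNReal) (g : X → ℝ), LipschitzWith L g →
    |∫ x, g x ∂(μ : Measure X) - ∫ x, g x ∂(ν : Measure X)| ≤ c * L

variable [BorelSpace X]

theorem integrable_of_continuous [CompactSpace X] (μ : ProbabilityMeasure X) {g : X → ℝ}
    (hg : Continuous g) : Integrable g (μ : Measure X) :=
  hg.integrable_of_hasCompactSupport (HasCompactSupport.of_compactSpace g)

theorem lipschitzClose_diam [CompactSpace X] (μ ν : ProbabilityMeasure X) :
    LipschitzClose (2 * Metric.diam (Set.univ : Set X)) μ ν := by
  intro L g hg
  obtain ⟨x₀⟩ := μ.nonempty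
  have h (ρ : ProbabilityMeasure X) :
      |∫ x, g x ∂(ρ : Measure X) - g x₀| ≤ L * Metric.diam (Set.univ : Set X) := by
    have h1 : ∫ x, g x ∂(ρ : Measure X) - g x₀ = ∫ x, (g x - g x₀) ∂(ρ : Measure X) := by
      rw [integral_sub (integrable_of_continuous ρ hg.continuous) (integrable_const _)]
      simp
    rw [h1, ← Real.norm_eq_abs]
    refine (norm_integral_le_of_norm_le_const (C := L * Metric.diam (Set.univ : Set X))
      (Filter.Eventually.of_forall fun x => ?_)).trans (by simp)
    rw [← dist_eq_norm]
    refine (hg.dist_le_mul x x₀).trans ?_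
    gcongr
    exact Metric.dist_le_diam_of_mem isCompact_univ.isBounded trivial trivial
  -- Both integrals are compared with `g x₀`, whence the factor 2.
  have h2 := abs_sub_le (∫ x, g x ∂(μ : Measure X)) (g x₀) (∫ x, g x ∂(ν : Measure X))
  rw [abs_sub_comm (g x₀)] at h2
  linarith [h μ, h ν]

/-- Lipschitz test functions detect weak convergence, so the constant sequence `μ` tends to `ν`, and
weak limits are unique. -/
theorem eq_of_forall_lipschitzClose {μ ν : ProbabilityMeasure X}
    (h : ∀ ε > 0, LipschitzClose ε μ ν) : μ = ν := by
  have key : Filter.Tendsto (fun _ : ℕ => μ) Filter.atTop (nhds ν) := by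
    rw [tendsto_iff_forall_lipschitz_integral_tendsto]
    rintro g - ⟨L, hL⟩
    have : ∫ x, g x ∂(μ : Measure X) = ∫ x, g x ∂(ν : Measure X) := by
      rw [← sub_eq_zero, ← abs_nonpos_iff]
      refine le_of_forall_pos_le_add fun ε hε => ?_
      -- `L` may be zero, so the division is by `L + 1`.
      have hL1 : (0 : ℝ) < L + 1 := by positivity
      calc _ ≤ ε / (L + 1) * L := h _ (by positivity) L g hL
        _ ≤ ε / (L + 1) * (L + 1) := by gcongr; linarith
        _ = 0 + ε := by field_simp; ring
    simp [this]
  exact tendsto_nhds_unique tendsto_const_nhds key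

end Discrepancy

/-! ### Fixed points of the Markov operator -/

section Markov

variable {X : Type*} [MetricSpace X] [CompactSpace X] [MeasurableSpace X] [BorelSpace X] {n : ℕ}

theorem integral_markov (f : IFS X n) (p : stdSimplex ℝ (Fin n)) (μ : ProbabilityMeasure X)
    {g : X → ℝ} (hg : Continuous g) :
    ∫ x, g x ∂(markov f p μ : Measure X) =
      ∑ i, p.1 i * ∫ x, g (f.map i x) ∂(μ : Measure X) := by
  have hmap (i : Fin n) : Integrable g ((μ : Measure X).map (f.map i)) :=
    (integrable_map_measure hg.aestronglyMeasurable (f.measurable_map i).aemeasurable).2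
      (integrable_of_continuous μ (hg.comp (f.continuous_map i)))
  change ∫ x, g x ∂(∑ i, ENNReal.ofReal (p.1 i) • (μ : Measure X).map (f.map i)) = _
  rw [integral_finsetSum_measure fun i _ => (hmap i).smul_measure ENNReal.ofReal_ne_top]
  refine Finset.sum_congr rfl fun i _ => ?_
  rw [integral_smul_measure, ENNReal.toReal_ofReal (p.2.1 i),
    integral_map (f.measurable_map i).aemeasurable hg.aestronglyMeasurable, smul_eq_mul]

theorem continuous_markov (f : IFS X n) :
    Continuous fun q : stdSimplex ℝ (Fin n) × ProbabilityMeasure X => markov f q.1 q.2 := by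
  rw [ProbabilityMeasure.continuous_iff_forall_continuousMap_continuous_integral]
  intro g
  simp_rw [integral_markov f _ _ g.continuous]
  refine continuous_finsetSum _ fun i _ => ?_
  refine ((continuous_apply i).comp (continuous_subtype_val.comp continuous_fst)).mul ?_
  exact (ProbabilityMeasure.continuous_integral_continuousMap
    (g.comp ⟨f.map i, f.continuous_map i⟩)).comp continuous_snd

/-- Each `g ∘ f.map i` is `L * k`-Lipschitz, and the weights average these bounds. -/
theorem LipschitzClose.markov {f : IFS X n} {k : NNReal} (hk : ∀ i, LipschitzWith k (f.map i))
    (p : stdSimplex ℝ (Fin n)) {c : ℝ} {μ ν : ProbabilityMeasure X} (h : LipschitzClose c μ ν) :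
    LipschitzClose (k * c) (markov f p μ) (markov f p ν) := by
  intro L g hg
  rw [integral_markov f p μ hg.continuous, integral_markov f p ν hg.continuous,
    ← Finset.sum_sub_distrib]
  calc |∑ i, (p.1 i * ∫ x, g (f.map i x) ∂(μ : Measure X) -
        p.1 i * ∫ x, g (f.map i x) ∂(ν : Measure X))|
      ≤ ∑ i, p.1 i * (k * c * L) := by
        refine (Finset.abs_sum_le_sum_abs _ _).trans (Finset.sum_le_sum fun i _ => ?_)
        rw [← mul_sub, abs_mul, abs_of_nonneg (p.2.1 i)]
        refine mul_le_mul_of_nonneg_left ((h _ _ (hg.comp (hk i))).trans_eq ?_) (p.2.1 i)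
        push_cast
        ring
    _ = k * c * L := by
        have hp : ∑ i, p.1 i = 1 := p.2.2
        rw [← Finset.sum_mul, hp, one_mul]

theorem lipschitzClose_iterate_markov {f : IFS X n} {k : NNReal}
    (hk : ∀ i, LipschitzWith k (f.map i)) (p : stdSimplex ℝ (Fin n)) (m : ℕ)
    (μ ν : ProbabilityMeasure X) :
    LipschitzClose (k ^ m * (2 * Metric.diam (Set.univ : Set X)))
      ((ImpreciseIFS.markov f p)^[m] μ) ((ImpreciseIFS.markov f p)^[m] ν) := by
  induction m with
  | zero => simpa using lipschitzClose_diam μ ν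
  | succ m ih =>
    rw [Function.iterate_succ_apply', Function.iterate_succ_apply', pow_succ', mul_assoc]
    exact ih.markov hk p

theorem eq_of_forall_mem_range_iterate_markov (f : IFS X n) (p : stdSimplex ℝ (Fin n))
    {μ ν : ProbabilityMeasure X} (hμ : ∀ m : ℕ, μ ∈ Set.range (markov f p)^[m])
    (hν : ∀ m : ℕ, ν ∈ Set.range (markov f p)^[m]) : μ = ν := by
  obtain ⟨k, hk1, hk⟩ := f.exists_lipschitzWith_lt_one
  refine eq_of_forall_lipschitzClose fun ε hε => ?_
  have hlim : Filter.Tendsto (fun m : ℕ => (k : ℝ) ^ m * (2 * Metric.diam (Set.univ : Set X)))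
      Filter.atTop (nhds 0) := by
    simpa using (tendsto_pow_atTop_nhds_zero_of_lt_one k.2 (by exact_mod_cast hk1)).mul_const
      (2 * Metric.diam (Set.univ : Set X))
  obtain ⟨m, hm⟩ := (hlim.eventually (gt_mem_nhds hε)).exists
  obtain ⟨μ', rfl⟩ := hμ m
  obtain ⟨ν', rfl⟩ := hν m
  intro L g hg
  exact (lipschitzClose_iterate_markov hk p m μ' ν' L g hg).trans (by gcongr)

theorem eq_of_markov_eq (f : IFS X n) (p : stdSimplex ℝ (Fin n)) {μ ν : ProbabilityMeasure X}
    (hμ : markov f p μ = μ) (hν : markov f p ν = ν) : μ = ν :=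
  eq_of_forall_mem_range_iterate_markov f p
    (fun m => ⟨μ, Function.iterate_fixed hμ m⟩) (fun m => ⟨ν, Function.iterate_fixed hν m⟩)

variable [Nonempty X]

theorem exists_markov_eq (f : IFS X n) (p : stdSimplex ℝ (Fin n)) :
    ∃ μ : ProbabilityMeasure X, markov f p μ = μ := by
  have hc : Continuous (markov f p) :=
    (continuous_markov f).comp (Continuous.prodMk continuous_const continuous_id)
  have hrange (m : ℕ) : Set.range (markov f p)^[m + 1] ⊆ Set.range (markov f p)^[m] := by
    rw [Function.iterate_succ]
    exact Set.range_comp_subset_range _ _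
  have hcpt (m : ℕ) : IsCompact (Set.range (markov f p)^[m]) := isCompact_range (hc.iterate m)
  obtain ⟨μ, hμ⟩ := IsCompact.nonempty_iInter_of_sequence_nonempty_isCompact_isClosed
    (fun m => Set.range (markov f p)^[m]) hrange (fun m => Set.range_nonempty _) (hcpt 0)
    (fun m => (hcpt m).isClosed)
  rw [Set.mem_iInter] at hμ
  -- The image of `μ` lies in the range of every iterate of order `m + 1`, hence in that of order
  -- `m`.
  refine ⟨μ, eq_of_forall_mem_range_iterate_markov f p (fun m => ?_) hμ⟩
  obtain ⟨ν, hν⟩ := hμ m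
  refine hrange m ⟨ν, ?_⟩
  rw [Function.iterate_succ_apply', hν]

theorem markov_fixH (f : IFS X n) (p : stdSimplex ℝ (Fin n)) :
    markov f p (fixH f p) = fixH f p :=
  Classical.epsilon_spec (exists_markov_eq f p)

theorem markov_eq_iff (f : IFS X n) (p : stdSimplex ℝ (Fin n)) (μ : ProbabilityMeasure X) :
    markov f p μ = μ ↔ μ = fixH f p :=
  ⟨fun h => eq_of_markov_eq f p h (markov_fixH f p), fun h => h ▸ markov_fixH f p⟩

/-- Closed graph argument: projection along the compact space `P(X)` is a closed map. -/
theorem continuous_fixH (f : IFS X n) : Continuous (fixH f) := by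
  rw [continuous_iff_isClosed]
  intro F hF
  have h : fixH f ⁻¹' F = Prod.fst ''
      ({q : stdSimplex ℝ (Fin n) × ProbabilityMeasure X | markov f q.1 q.2 = q.2} ∩
        Prod.snd ⁻¹' F) := by
    ext p
    constructor
    · exact fun hp => ⟨(p, fixH f p), ⟨markov_fixH f p, hp⟩, rfl⟩
    · rintro ⟨⟨p, μ⟩, ⟨h1, h2⟩, rfl⟩
      rwa [Set.mem_preimage, ← (markov_eq_iff f p μ).1 h1]
  rw [h]
  exact isClosedMap_fst_of_compactSpace _
    ((isClosed_eq (continuous_markov f) continuous_snd).inter (hF.preimage continuous_snd))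

end Markov

section Monotone

variable {X : Type*} [MeasurableSpace X]

theorem le_coe_apply_iff {ν : ProbabilityMeasure X} {C : Set X} {r : ℝ} :
    r ≤ ((ν C : NNReal) : ℝ) ↔ ENNReal.ofReal r ≤ (ν : Measure X) C := by
  rw [← ν.ennreal_coeFn_eq_coeFn_toMeasure, ← ENNReal.ofReal_coe_nnreal,
    ENNReal.ofReal_le_ofReal_iff (NNReal.coe_nonneg _)]

theorem upperProb_mono {A B : Set (ProbabilityMeasure X)} (hAB : A ⊆ B) {C D : Set X}
    (hCD : C ⊆ D) : upperProb A C ≤ upperProb B D := by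
  -- Nonnegativity of the bound covers empty `A`, where `sSup` is 0.
  refine Real.sSup_le ?_ (upperProb_mem B D).1
  rintro _ ⟨ν, hν, rfl⟩
  exact (NNReal.coe_le_coe.2 (ν.apply_mono hCD)).trans (le_upperProb (hAB hν) D)

end Monotone

/-! ### Semicontinuity on closed sets -/

section ClosedSets

variable {X : Type*} [MeasurableSpace X] [TopologicalSpace X] [OpensMeasurableSpace X]

/-- The closed-set half of the portmanteau theorem. -/
theorem upperSemicontinuous_apply [HasOuterApproxClosed X] {C : Set X} (hC : IsClosed C) :
    UpperSemicontinuous fun ν : ProbabilityMeasure X => (ν : Measure X) C :=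
  upperSemicontinuous_iff_limsup_le.2 fun _ =>
    ProbabilityMeasure.limsup_measure_closed_le_of_tendsto Filter.tendsto_id hC

theorem isClosed_setOf_le_apply [HasOuterApproxClosed X] {C : Set X} (hC : IsClosed C) (r : ℝ) :
    IsClosed {ν : ProbabilityMeasure X | r ≤ ((ν C : NNReal) : ℝ)} := by
  simp_rw [le_coe_apply_iff]
  exact (upperSemicontinuous_apply hC).isClosed_preimage _

theorem isGreatest_upperProb [HasOuterApproxClosed X] {A : Set (ProbabilityMeasure X)}
    (hA : IsCompact A) (hne : A.Nonempty) {C : Set X} (hC : IsClosed C) :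
    IsGreatest (values A C) (upperProb A C) := by
  obtain ⟨ν, hν, hmax⟩ := ((upperSemicontinuous_apply hC).upperSemicontinuousOn A).exists_isMaxOn
    hne hA
  have h : IsGreatest (values A C) ((ν C : NNReal) : ℝ) := by
    refine ⟨⟨ν, hν, rfl⟩, ?_⟩
    rintro _ ⟨ρ, hρ, rfl⟩
    have := hmax hρ
    simp only [Set.mem_ofPred_eq, ← ProbabilityMeasure.ennreal_coeFn_eq_coeFn_toMeasure] at this
    exact_mod_cast this
  rwa [upperProb, h.csSup_eq]

/-- A probability measure on a compact metric space is continuous along directed intersections of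
closed sets. -/
theorem le_apply_of_directed {X : Type*} [MeasurableSpace X] [MetricSpace X] [CompactSpace X]
    [BorelSpace X] {ι : Type*} [Nonempty ι] {V : ι → Set X} (hdir : Directed (· ⊇ ·) V)
    (hV : ∀ i, IsClosed (V i)) {C : Set X} (hC : ⋂ i, V i ⊆ C) {ν : ProbabilityMeasure X} {r : ℝ}
    (h : ∀ i, r ≤ ((ν (V i) : NNReal) : ℝ)) : r ≤ ((ν C : NNReal) : ℝ) := by
  -- By outer regularity it suffices to bound open `U ⊇ C`; by compactness some `V i` already lies
  -- in `U`.
  rw [le_coe_apply_iff, Set.measure_eq_iInf_isOpen]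
  refine le_iInf₂ fun U hCU => le_iInf fun hU => ?_
  obtain ⟨i, hi⟩ := exists_subset_nhds_of_compactSpace hdir hV
    fun x hx => hU.mem_nhds (hCU (hC hx))
  exact (le_coe_apply_iff.1 (h i)).trans (measure_mono hi)

end ClosedSets

/-! ### Compactness in the weights -/

section Fixed

variable {X : Type*} [MetricSpace X] [CompactSpace X] [Nonempty X] [MeasurableSpace X]
  [BorelSpace X] {n : ℕ} {lo hi : Fin n → ℝ}

theorem continuous_fixH_admissible (f : IFS X n) :
    Continuous fun p : admissible lo hi => fixH f ⟨p.1, p.2.1⟩ :=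
  (continuous_fixH f).comp (continuous_subtype_val.subtype_mk _)

theorem isCompact_fixSet (f : IFS X n) (A : UpperSpace (admissible lo hi)) :
    IsCompact (fixSet f A) :=
  (OrderDual.ofDual A).isCompact.image (continuous_fixH_admissible f)

theorem exists_forall_le_fixH_of_directed (f : IFS X n) {ι : Type*} [Nonempty ι]
    {A : ι → UpperSpace (admissible lo hi)} {C : ι → Set X} (hC : ∀ i, IsClosed (C i))
    (hdir : ∀ i j, ∃ l, ((A l).carrier ⊆ (A i).carrier ∧ C l ⊆ C i) ∧
      (A l).carrier ⊆ (A j).carrier ∧ C l ⊆ C j) {r : ℝ}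
    (h : ∀ i, r ≤ upperProb (fixSet f (A i)) (C i)) :
    ∃ p : admissible lo hi, (∀ i, p ∈ (A i).carrier) ∧
      r ≤ ((fixH f ⟨p.1, p.2.1⟩ (⋂ i, C i) : NNReal) : ℝ) := by
  -- Compact by semicontinuity, non-empty because the maximum is attained.
  let S (i : ι) : Set (admissible lo hi) :=
    (A i).carrier ∩ {p | r ≤ ((fixH f ⟨p.1, p.2.1⟩ (C i) : NNReal) : ℝ)}
  have hclosed (i : ι) :
      IsClosed {p : admissible lo hi | r ≤ ((fixH f ⟨p.1, p.2.1⟩ (C i) : NNReal) : ℝ)} :=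
    (isClosed_setOf_le_apply (hC i) r).preimage (continuous_fixH_admissible f)
  have hScpt (i : ι) : IsCompact (S i) :=
    (OrderDual.ofDual (A i)).isCompact.inter_right (hclosed i)
  have hSne (i : ι) : (S i).Nonempty := by
    obtain ⟨⟨_, ⟨p, hp, rfl⟩, hpr⟩, -⟩ := isGreatest_upperProb (isCompact_fixSet f (A i))
      ((OrderDual.ofDual (A i)).nonempty.image _) (hC i)
    exact ⟨p, hp, (h i).trans_eq hpr.symm⟩
  have hSmono {i l : ι} (hA : (A l).carrier ⊆ (A i).carrier) (hCC : C l ⊆ C i) : S l ⊆ S i :=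
    fun p hp => ⟨hA hp.1, hp.2.trans (NNReal.coe_le_coe.2 (ProbabilityMeasure.apply_mono _ hCC))⟩
  obtain ⟨p, hp⟩ := IsCompact.nonempty_iInter_of_directed_nonempty_isCompact_isClosed S
    (fun i j => (hdir i j).imp fun l hl => ⟨hSmono hl.1.1 hl.1.2, hSmono hl.2.1 hl.2.2⟩)
    hSne hScpt (fun i => (hScpt i).isClosed)
  rw [Set.mem_iInter] at hp
  exact ⟨p, fun i => (hp i).1, le_apply_of_directed
    (fun i j => (hdir i j).imp fun l hl => ⟨hl.1.2, hl.2.2⟩) hC subset_rfl fun i => (hp i).2⟩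

end Fixed

/-! ### Directed suprema -/

section Suprema

/-- The intersection is non-empty by compactness, so it is itself an upper bound. -/
theorem iInter_carrier_subset_of_isLUB {Y : Type*} [TopologicalSpace Y] [T2Space Y]
    {d : Set (UpperSpace Y)} (hne : d.Nonempty) (hdir : DirectedOn (· ≤ ·) d) {A : UpperSpace Y}
    (hA : IsLUB d A) : ⋂ B : d, B.1.carrier ⊆ A.carrier := by
  have := hne.to_subtype
  have hcpt (B : UpperSpace Y) : IsCompact B.carrier := (OrderDual.ofDual B).isCompact
  have hcl : IsClosed (⋂ B : d, B.1.carrier) := isClosed_iInter fun B => (hcpt B).isClosed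
  have hI : (⋂ B : d, B.1.carrier).Nonempty :=
    IsCompact.nonempty_iInter_of_directed_nonempty_isCompact_isClosed _ hdir.directed_val
      (fun B => (OrderDual.ofDual B.1).nonempty) (fun B => hcpt B) (fun B => (hcpt B).isClosed)
  let I : NonemptyCompacts Y := ⟨⟨⋂ B : d, B.1.carrier,
    (hcpt hne.some).of_isClosed_subset hcl
      (Set.iInter_subset _ (⟨hne.some, hne.some_mem⟩ : d))⟩, hI⟩
  have hub : OrderDual.toDual I ∈ upperBounds d := fun B hB =>
    show (I : Set Y) ⊆ (OrderDual.ofDual B : NonemptyCompacts Y) from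
      Set.iInter_subset (fun B : d => B.1.carrier) ⟨B, hB⟩
  exact hA.2 hub

variable {X : Type*} [TopologicalSpace X]

theorem DualEvent.isClosed_fst (C : DualEvent X) : IsClosed C.fst :=
  (OrderDual.ofDual C.1.1).isClosed

theorem DualEvent.isClosed_snd (C : DualEvent X) : IsClosed C.snd :=
  (OrderDual.ofDual C.1.2).isClosed

theorem DualEvent.le_iff {C D : DualEvent X} : C ≤ D ↔ D.fst ⊆ C.fst ∧ D.snd ⊆ C.snd := Iff.rfl

theorem UpperSpace.le_iff {A B : UpperSpace X} : A ≤ B ↔ B.carrier ⊆ A.carrier := Iff.rfl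

theorem DualEvent.iInter_subset_of_isLUB {d : Set (DualEvent X)} (hdir : DirectedOn (· ≤ ·) d)
    {C : DualEvent X} (hC : IsLUB d C) :
    ⋂ D : d, D.1.fst ⊆ C.fst ∧ ⋂ D : d, D.1.snd ⊆ C.snd := by
  let I₁ : Closeds X := ⟨⋂ D : d, D.1.fst, isClosed_iInter fun D => D.1.isClosed_fst⟩
  let I₂ : Closeds X := ⟨⋂ D : d, D.1.snd, isClosed_iInter fun D => D.1.isClosed_snd⟩
  have hI : (I₁ : Set X) ∪ (I₂ : Set X) = Set.univ := by
    refine Set.eq_univ_of_forall fun x => ?_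
    -- If `x` misses `D.fst` and `E.snd`, it misses both halves of any `F` above `D` and `E`, which
    -- cover the space.
    by_contra hx
    rw [Set.mem_union, not_or] at hx
    obtain ⟨D, hD⟩ := not_forall.1 (mt Set.mem_iInter.2 hx.1)
    obtain ⟨E, hE⟩ := not_forall.1 (mt Set.mem_iInter.2 hx.2)
    obtain ⟨F, -, hDF, hEF⟩ := hdir D D.2 E E.2
    have hxF : x ∈ F.fst ∪ F.snd := (show F.fst ∪ F.snd = Set.univ from F.2) ▸ Set.mem_univ x
    exact hxF.elim (fun h => hD (hDF.1 h)) (fun h => hE (hEF.2 h))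
  let I : DualEvent X := ⟨(OrderDual.toDual I₁, OrderDual.toDual I₂), hI⟩
  have hub : I ∈ upperBounds d := fun D hD => DualEvent.le_iff.2
    ⟨Set.iInter_subset (fun D : d => D.1.fst) ⟨D, hD⟩,
      Set.iInter_subset (fun D : d => D.1.snd) ⟨D, hD⟩⟩
  exact hC.2 hub

theorem envelope_le_iff [MeasurableSpace X] [OpensMeasurableSpace X]
    {q : UpperSpace (ProbabilityMeasure X) × DualEvent X} {I : IntervalDomain} :
    envelope q ≤ I ↔
      1 - upperProb q.1.carrier q.2.fst ≤ ((OrderDual.ofDual I).fst : ℝ) ∧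
        ((OrderDual.ofDual I).snd : ℝ) ≤ upperProb q.1.carrier q.2.snd := Iff.rfl

end Suprema

theorem scottContinuous_envelope_fixMap {X : Type*} [MetricSpace X] [CompactSpace X] [Nonempty X]
    [MeasurableSpace X] [BorelSpace X] {n : ℕ} (f : IFS X n) {lo hi : Fin n → ℝ}
    (h : ∀ A : UpperSpace (admissible lo hi), IsCompact (fixSet f A)) :
    ScottContinuous fun q : UpperSpace (admissible lo hi) × DualEvent X =>
      envelope (fixMap f h q.1, q.2) := by
  intro d hne hdir a ha
  have hne' := hne.to_subtype
  obtain ⟨ha₁, ha₂⟩ := isLUB_prod.1 ha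
  have hA := iInter_carrier_subset_of_isLUB (hne.image Prod.fst)
    (hdir.mono_comp fun _ _ hxy => hxy.1) ha₁
  have hC := DualEvent.iInter_subset_of_isLUB (hdir.mono_comp fun _ _ hxy => hxy.2) ha₂
  have hA' {p : admissible lo hi} (hp : ∀ q : d, p ∈ q.1.1.carrier) : p ∈ a.1.carrier := by
    refine hA (Set.mem_iInter.2 ?_)
    rintro ⟨_, q, hq, rfl⟩
    exact hp ⟨q, hq⟩
  have hC₁ : ⋂ q : d, q.1.2.fst ⊆ a.2.fst := by
    refine (Set.subset_iInter ?_).trans hC.1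
    rintro ⟨_, q, hq, rfl⟩
    exact Set.iInter_subset (fun q : d => q.1.2.fst) ⟨q, hq⟩
  have hC₂ : ⋂ q : d, q.1.2.snd ⊆ a.2.snd := by
    refine (Set.subset_iInter ?_).trans hC.2
    rintro ⟨_, q, hq, rfl⟩
    exact Set.iInter_subset (fun q : d => q.1.2.snd) ⟨q, hq⟩
  -- Used for both endpoints, with `C` the first or the second component.
  have hbound {C : DualEvent X → Set X} (hcl : ∀ D, IsClosed (C D)) (hmono : Antitone C)
      (hsub : ⋂ q : d, C q.1.2 ⊆ C a.2) {r : ℝ}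
      (hr : ∀ q ∈ d, r ≤ upperProb (fixSet f q.1) (C q.2)) :
      r ≤ upperProb (fixSet f a.1) (C a.2) := by
    obtain ⟨p, hp, hpr⟩ := exists_forall_le_fixH_of_directed f (A := fun q : d => q.1.1)
      (C := fun q : d => C q.1.2) (fun q => hcl _)
      (fun q s => (hdir.directed_val q s).imp fun t ht =>
        ⟨⟨UpperSpace.le_iff.1 ht.1.1, hmono ht.1.2⟩, UpperSpace.le_iff.1 ht.2.1, hmono ht.2.2⟩)
      fun q => hr q q.2
    exact hpr.trans ((NNReal.coe_le_coe.2 (ProbabilityMeasure.apply_mono _ hsub)).trans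
      (le_upperProb (A := fixSet f a.1) ⟨p, hA' hp, rfl⟩ _))
  constructor
  · rintro _ ⟨q, hq, rfl⟩
    obtain ⟨h₁, h₂⟩ : q.1 ≤ a.1 ∧ q.2 ≤ a.2 := ha.1 hq
    have hfix : fixSet f a.1 ⊆ fixSet f q.1 := Set.image_mono (UpperSpace.le_iff.1 h₁)
    exact envelope_le_iff.2 ⟨sub_le_sub_left (upperProb_mono hfix (DualEvent.le_iff.1 h₂).1) 1,
      upperProb_mono hfix (DualEvent.le_iff.1 h₂).2⟩
  · intro I hI
    have hI' (q) (hq : q ∈ d) := envelope_le_iff.1 (hI ⟨q, hq, rfl⟩)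
    refine envelope_le_iff.2 ⟨?_, ?_⟩
    -- An upper bound on the left endpoint is a lower bound, with `r` equal to 1 minus it, on the
    -- upper probability of the first set.
    · rw [sub_le_comm]
      exact hbound DualEvent.isClosed_fst (fun _ _ hCD => hCD.1) hC₁
        fun q hq => sub_le_comm.1 (hI' q hq).1
    · exact hbound DualEvent.isClosed_snd (fun _ _ hCD => hCD.2) hC₂ fun q hq => (hI' q hq).2

end ImpreciseIFS

theorem mainTheorem9 {X : Type*} [MetricSpace X] [CompactSpace X] [Nonempty X]
    [MeasurableSpace X] [BorelSpace X] {n : ℕ} (f : ImpreciseIFS.IFS X n)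
    (lo hi : Fin n → ℝ) :
    -- `fixH f p` is the unique invariant probability measure, for every admissible `p`
    (∀ (p : ImpreciseIFS.admissible lo hi) (μ : ProbabilityMeasure X),
      ImpreciseIFS.markov f ⟨p.1, p.2.1⟩ μ = μ ↔ μ = ImpreciseIFS.fixH f ⟨p.1, p.2.1⟩) ∧
    -- the suprema defining the envelope map are attained
    (∀ (A : ImpreciseIFS.UpperSpace (ProbabilityMeasure X)) (C : Set X), IsClosed C →
      IsGreatest (ImpreciseIFS.values A.carrier C) (ImpreciseIFS.upperProb A.carrier C)) ∧
    -- `fix(H_{f,[-]})` is well-defined, and its composition with the envelope map is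
    -- Scott continuous
    ∃ h : ∀ A : ImpreciseIFS.UpperSpace (ImpreciseIFS.admissible lo hi),
        IsCompact (ImpreciseIFS.fixSet f A),
      ScottContinuous
        (fun q : ImpreciseIFS.UpperSpace (ImpreciseIFS.admissible lo hi) ×
            ImpreciseIFS.DualEvent X =>
          ImpreciseIFS.envelope (ImpreciseIFS.fixMap f h q.1, q.2)) := by
  exact ⟨fun p μ => ImpreciseIFS.markov_eq_iff f _ μ,
    fun A C hC => ImpreciseIFS.isGreatest_upperProb (OrderDual.ofDual A).isCompact
      (OrderDual.ofDual A).nonempty hC,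
    ImpreciseIFS.isCompact_fixSet f, ImpreciseIFS.scottContinuous_envelope_fixMap f _⟩
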